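/- Rings are associative and unital. For a ring $R$, let $\mathsf{D}(R)$ be the derived category of the category of right $R$-modules, and regard right $R$-modules as complexes concentrated in degree $0$. A localizing subcategory of $\mathsf{D}(R)$ is a triangulated subcategory closed under set-indexed coproducts. We say that \emph{injectives generate for $R$} if the smallest localizing subcategory of $\mathsf{D}(R)$ that contains all injective right $R$-modules is $\mathsf{D}(R)$ itself. Let $A$ and $B$ be rings, $N$ an $A$-$B$-bimodule and $M$ a $B$-$A$-bimodule. Let $\Lambda=\begin{pmatrix} A & N\\ M & B\end{pmatrix}$ be the Morita context ring with zero bimodule homomorphisms, that is, the set of such matrices with componentwise addition and the multiplication $$\begin{pmatrix} a & n\\ m & b\end{pmatrix}\begin{pmatrix} a' & n'\\ m' & b'\end{pmatrix}=\begin{pmatrix} aa' & an'+nb'\\ ma'+bm' & bb'\end{pmatrix}.$$ Let $\mathsf{Z}_A(A)$ be the left $\Lambda$-module $A$ on which $\begin{pmatrix} a & n\\ m & b\end{pmatrix}$ acts as left multiplication by $a$, and let $\mathsf{Z}_B(B)$ be the left $\Lambda$-module $B$ on which it acts as left multiplication by $b$. Write $\mathrm{pd}$ for the projective dimension of left modules.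 (i) Assume that $\mathrm{pd}_A N<\infty$. If injectives generate for $\Lambda$, then injectives generate for $A$. (ii) Assume that $\mathrm{pd}_B M<\infty$. If injectives generate for $\Lambda$, then injectives generate for $B$. (iii) Assume that $\mathrm{pd}_\Lambda \mathsf{Z}_A(A)<\infty$ and $\mathrm{pd}_\Lambda \mathsf{Z}_B(B)<\infty$. If injectives generate for $A$ and for $B$, then injectives generate for $\Lambda$. -/

import Mathlib

open CategoryTheory CategoryTheory.Limits MulOpposite

universe w v u

/-! ### Localizing subcategories and injective generation -/

section Localizing

variable {T : Type v} [Category.{w} T] [HasZeroObject T] [Preadditive T] [HasShift T ℤ]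
  [∀ n : ℤ, (shiftFunctor T n).Additive] [Pretriangulated T]

/-- A (strictly full) subcategory of a triangulated category is localizing if it is a triangulated
subcategory closed under all coproducts indexed by sets (that is, by types in `Type u`).
The second field includes closure under isomorphisms (coproducts of one object). -/
structure IsLocalizing (P : ObjectProperty T) : Prop where
  isTriangulated : P.IsTriangulated
  closedUnderCoproducts : ∀ ι : Type u, P.IsClosedUnderColimitsOfShape (Discrete ι)

/-- `Loc(S)`: the smallest localizing subcategory that contains the class `S` of objects, given as
the intersection of all localizing subcategories that contain `S`. -/
def Loc (S : ObjectProperty T) : ObjectProperty T :=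
  fun X => ∀ P : ObjectProperty T, IsLocalizing.{w, v, u} P → S ≤ P → P X

/-- `S` generates `T` if `Loc(S) = T`. -/
def Generates (S : ObjectProperty T) : Prop :=
  Loc.{w, v, u} S = ⊤

end Localizing

/-- The injective objects of `C`, viewed in the derived category of `C` as complexes concentrated
in degree `0` (up to isomorphism). -/
def injectivesInDegreeZero (C : Type v) [Category.{u} C] [Abelian C] [HasDerivedCategory.{w} C] :
    ObjectProperty (DerivedCategory C) :=
  (isInjective C).map (DerivedCategory.singleFunctor C 0)

/-- Injectives generate for the ring `R`: the smallest localizing subcategory of the derived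
category `D(R)` of right `R`-modules that contains the injective right `R`-modules is `D(R)`.
Right `R`-modules are left modules over `Rᵐᵒᵖ`. -/
def InjectivesGenerate (R : Type u) [Ring R] : Prop :=
  letI := HasDerivedCategory.standard (ModuleCat.{u} Rᵐᵒᵖ)
  Generates.{_, _, u} (injectivesInDegreeZero (ModuleCat.{u} Rᵐᵒᵖ))

/-! ### Morita context rings with zero bimodule homomorphisms -/

/-- The set of matrices `(a n; m b)` with `a ∈ A`, `n ∈ N`, `m ∈ M`, `b ∈ B`. With the ring
structure below, it is the Morita context ring of `(A, N, B, M, φ, ψ)` with `φ = 0`, `ψ = 0`. -/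
@[ext]
structure MoritaRing (A N M B : Type u) : Type u where
  a : A
  n : N
  m : M
  b : B

namespace MoritaRing

variable {A N M B : Type u} [Ring A] [Ring B] [AddCommGroup N] [AddCommGroup M]

instance : Zero (MoritaRing A N M B) := ⟨⟨0, 0, 0, 0⟩⟩
instance : One (MoritaRing A N M B) := ⟨⟨1, 0, 0, 1⟩⟩
instance : Add (MoritaRing A N M B) := ⟨fun x y => ⟨x.a + y.a, x.n + y.n, x.m + y.m, x.b + y.b⟩⟩
instance : Neg (MoritaRing A N M B) := ⟨fun x => ⟨-x.a, -x.n, -x.m, -x.b⟩⟩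

@[simp] theorem zero_a : (0 : MoritaRing A N M B).a = 0 := rfl
@[simp] theorem zero_n : (0 : MoritaRing A N M B).n = 0 := rfl
@[simp] theorem zero_m : (0 : MoritaRing A N M B).m = 0 := rfl
@[simp] theorem zero_b : (0 : MoritaRing A N M B).b = 0 := rfl
@[simp] theorem one_a : (1 : MoritaRing A N M B).a = 1 := rfl
@[simp] theorem one_n : (1 : MoritaRing A N M B).n = 0 := rfl
@[simp] theorem one_m : (1 : MoritaRing A N M B).m = 0 := rfl
@[simp] theorem one_b : (1 : MoritaRing A N M B).b = 1 := rfl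
@[simp] theorem add_a (x y : MoritaRing A N M B) : (x + y).a = x.a + y.a := rfl
@[simp] theorem add_n (x y : MoritaRing A N M B) : (x + y).n = x.n + y.n := rfl
@[simp] theorem add_m (x y : MoritaRing A N M B) : (x + y).m = x.m + y.m := rfl
@[simp] theorem add_b (x y : MoritaRing A N M B) : (x + y).b = x.b + y.b := rfl
@[simp] theorem neg_a (x : MoritaRing A N M B) : (-x).a = -x.a := rfl
@[simp] theorem neg_n (x : MoritaRing A N M B) : (-x).n = -x.n := rfl
@[simp] theorem neg_m (x : MoritaRing A N M B) : (-x).m = -x.m := rfl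
@[simp] theorem neg_b (x : MoritaRing A N M B) : (-x).b = -x.b := rfl

variable [Module A N] [Module Bᵐᵒᵖ N] [Module B M] [Module Aᵐᵒᵖ M]

/-- `(a n; m b) (a' n'; m' b') = (aa', an' + nb'; ma' + bm', bb')`. The right actions of `B` on `N`
and of `A` on `M` are written as actions of the opposite rings. -/
instance : Mul (MoritaRing A N M B) :=
  ⟨fun x y => ⟨x.a * y.a, x.a • y.n + op y.b • x.n, op y.a • x.m + x.b • y.m, x.b * y.b⟩⟩

@[simp] theorem mul_a (x y : MoritaRing A N M B) : (x * y).a = x.a * y.a := rfl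
@[simp] theorem mul_n (x y : MoritaRing A N M B) :
    (x * y).n = x.a • y.n + op y.b • x.n := rfl
@[simp] theorem mul_m (x y : MoritaRing A N M B) :
    (x * y).m = op y.a • x.m + x.b • y.m := rfl
@[simp] theorem mul_b (x y : MoritaRing A N M B) : (x * y).b = x.b * y.b := rfl

variable [SMulCommClass A Bᵐᵒᵖ N] [SMulCommClass B Aᵐᵒᵖ M]

instance : Ring (MoritaRing A N M B) where
  add_assoc x y z := by ext <;> simp [add_assoc]
  zero_add x := by ext <;> simp
  add_zero x := by ext <;> simp
  add_comm x y := by ext <;> simp [add_comm]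
  neg_add_cancel x := by ext <;> simp
  nsmul := nsmulRec
  zsmul := zsmulRec
  mul_assoc x y z := by
    ext
    · simp [mul_assoc]
    · simp [mul_smul, smul_comm, add_assoc]
    · simp [mul_smul, smul_comm, add_assoc]
    · simp [mul_assoc]
  one_mul x := by ext <;> simp
  mul_one x := by ext <;> simp
  zero_mul x := by ext <;> simp
  mul_zero x := by ext <;> simp
  left_distrib x y z := by ext <;> simp [mul_add, add_smul] <;> abel
  right_distrib x y z := by ext <;> simp [add_mul, add_smul] <;> abel

variable (A N M B)

/-- The ring homomorphism `(a n; m b) ↦ a`. -/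
def toA : MoritaRing A N M B →+* A where
  toFun x := x.a
  map_zero' := rfl
  map_one' := rfl
  map_add' _ _ := rfl
  map_mul' _ _ := rfl

/-- The ring homomorphism `(a n; m b) ↦ b`. -/
def toB : MoritaRing A N M B →+* B where
  toFun x := x.b
  map_zero' := rfl
  map_one' := rfl
  map_add' _ _ := rfl
  map_mul' _ _ := rfl

/-- The functor `Z_A`, `X ↦ (X, 0, 0, 0)`, from left `A`-modules to left modules over the Morita
context ring: the abelian group is `X` (that is, `X ⊕ 0`), on which `(a n; m b)` acts as `a`. -/
noncomputable def Z_A : ModuleCat.{u} A ⥤ ModuleCat.{u} (MoritaRing A N M B) :=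
  ModuleCat.restrictScalars (toA A N M B)

/-- The functor `Z_B`, `Y ↦ (0, Y, 0, 0)`, from left `B`-modules to left modules over the Morita
context ring: the abelian group is `Y` (that is, `0 ⊕ Y`), on which `(a n; m b)` acts as `b`. -/
noncomputable def Z_B : ModuleCat.{u} B ⥤ ModuleCat.{u} (MoritaRing A N M B) :=
  ModuleCat.restrictScalars (toB A N M B)

end MoritaRing

/-!
The argument compares localizing subcategories along exact functors. The localization functor from
complexes to the derived category preserves coproducts (`DerivedCategory.preservesColimitsOfShape_Q`),
so the functor between derived categories induced by an exact coproduct-preserving functor `F`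
pulls localizing subcategories back to localizing subcategories. If moreover `F` takes injective
modules to modules of finite injective dimension, which have finite injective resolutions, and if
injectives generate for the source, then each complex in the image of `F` lies in every localizing
subcategory that contains the injective modules (`IsLocalizing.mapDerivedCategory_obj`).

Finite injective dimension of right modules comes from finite projective dimension of left modules
through the duality that takes a left `R`-module `L` to the right `R`-module `Hom_ℤ(L, D)`, where `D`
is an injective abelian group. It takes projective resolutions to injective resolutions
(`RightDual.hasInjectiveDimensionLT`), and each injective right `R`-module is a direct summand of
some `Hom_ℤ(R, D)` (`ModuleCat.exists_retract_rightDual`). So it suffices to compute `F` on these.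

Let `Λ` be the Morita context ring. For the descent to `A`, the functor `F` takes a right `Λ`-module
`X` to `X e`, where `e = (1 0; 0 0)`. On `Hom_ℤ(Λ, D)` its value is the dual of `e Λ = A × N`, and it
recovers a right `A`-module from the right `Λ`-module given by `Λ → A`, so that every complex of
right `A`-modules is in its image (`MoritaRing.injectivesGenerate_left`). The descent to `B` follows
by exchange of the two diagonal entries.

For the ascent, the functors `F` are the restrictions of scalars along `Λ → A` and `Λ → B`. They take
`Hom_ℤ(A, D)` and `Hom_ℤ(B, D)` to the duals of the left `Λ`-modules `A` and `B`. For a complex `K` of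
right `Λ`-modules, let `T K` be the sum of the subcomplexes annihilated by the kernels of `Λ → A` and
of `Λ → B`. The sum is direct, and it consists of the elements annihilated by the off-diagonal
matrices. As products of off-diagonal matrices are zero, the quotient `C` of `K` by `T K` satisfies
`T C = C`. Hence `K` is an extension of two complexes, each of which is a direct sum of a complex that
comes from `A` and one that comes from `B` (`IsLocalizing.of_two_step_filtration`).
-/

/-! ### Coproducts in derived categories -/

section Coproducts
universe w₁ w₂ v₁ v₂ u₁ u₂ t t'

/-- If colimits of shape `J` are exact, then a colimit of quasi-isomorphisms is one: a diagram of
complexes is a complex of diagrams, to which the exact functor `colim` applies. -/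
theorem HomologicalComplex.quasiIso_map_of_hasExactColimitsOfShape
    {C : Type u₁} [Category.{v₁} C] [Abelian C] {J : Type t} [Category.{t'} J]
    [HasColimitsOfShape J C] [HasExactColimitsOfShape J C]
    {F G : J ⥤ CochainComplex C ℤ} (φ : F ⟶ G) (hφ : ∀ j, QuasiIso (φ.app j)) :
    QuasiIso ((HomologicalComplex.isColimitCoconeOfHasColimitEval F).map
      (HomologicalComplex.coconeOfHasColimitEval G) φ) := by
  let K (H : J ⥤ CochainComplex C ℤ) : CochainComplex (J ⥤ C) ℤ :=
    { X n := H ⋙ HomologicalComplex.eval C _ n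
      d n m :=
        { app j := (H.obj j).d n m
          naturality _ _ f := (H.map f).comm n m }
      shape n m h := by ext j; exact (H.obj j).shape n m h
      d_comp_d' n m k _ _ := by ext j; exact (H.obj j).d_comp_d n m k }
  let ψ : K F ⟶ K G :=
    { f n := Functor.whiskerRight φ (HomologicalComplex.eval C _ n)
      comm' n m _ := by ext j; exact (φ.app j).comm n m }
  have : QuasiIso ψ := by
    rw [HomologicalComplex.quasiIso_iff_evaluation]
    exact hφ
  let e (H : J ⥤ CochainComplex C ℤ) : (HomologicalComplex.coconeOfHasColimitEval H).pt ≅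
      ((colim : (J ⥤ C) ⥤ C).mapHomologicalComplex _).obj (K H) :=
    HomologicalComplex.Hom.isoOfComponents (fun n ↦ Iso.refl _) (fun n m _ ↦ by
      refine (Category.id_comp _).trans (Eq.trans ?_ (Category.comp_id _).symm)
      rfl)
  refine (quasiIso_iff_of_arrow_mk_iso _ _
    (Arrow.isoMk (e F) (e G) ?_)).2
      (inferInstance : QuasiIso (((colim : (J ⥤ C) ⥤ C).mapHomologicalComplex _).map ψ))
  refine (HomologicalComplex.isColimitCoconeOfHasColimitEval F).hom_ext fun j ↦ ?_
  ext n
  have h₁ : (HomologicalComplex.coconeOfHasColimitEval F).ι.app j ≫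
      (HomologicalComplex.isColimitCoconeOfHasColimitEval F).map _ φ = φ.app j ≫
        (HomologicalComplex.coconeOfHasColimitEval G).ι.app j :=
    IsColimit.ι_map _ _ _ _
  have h₂ : colimit.ι (F ⋙ HomologicalComplex.eval C _ n) j ≫ colim.map (ψ.f n) =
      (φ.app j).f n ≫ colimit.ι (G ⋙ HomologicalComplex.eval C _ n) j :=
    ι_colimMap _ _
  have h₃ := congr_arg (fun k ↦ HomologicalComplex.Hom.f k n) h₁
  refine Eq.trans ?_ (h₂.trans (h₃.symm.trans ?_))
  · exact congr_arg (colimit.ι (F ⋙ HomologicalComplex.eval C _ n) j ≫ ·) (Category.id_comp _)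
  · exact congr_arg (colimit.ι (F ⋙ HomologicalComplex.eval C _ n) j ≫ ·)
      (Category.comp_id _).symm

variable {C : Type u₁} [Category.{v₁} C] [Abelian C] [HasDerivedCategory.{w₁} C] {J : Type t}

/-- A morphism out of a coproduct of complexes is null-homotopic if its components are: the
null-homotopies of the components assemble to one of the given morphism. -/
theorem CochainComplex.Q_map_eq_zero_of_isColimit {F : Discrete J ⥤ CochainComplex C ℤ}
    {c : Cocone F} (hc : ∀ n, IsColimit ((HomologicalComplex.eval C _ n).mapCocone c))
    {Y : CochainComplex C ℤ} (f : c.pt ⟶ Y) (h : ∀ j, Homotopy (c.ι.app j ≫ f) 0) :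
    DerivedCategory.Q.map f = 0 := by
  have hz (j) : ∃ z : CochainComplex.HomComplex.Cochain (F.obj j) Y (-1),
      CochainComplex.HomComplex.Cochain.ofHom (c.ι.app j ≫ f) =
        CochainComplex.HomComplex.δ (-1) 0 z := by
    obtain ⟨z, hz⟩ := CochainComplex.HomComplex.Cochain.equivHomotopy _ _ (h j)
    exact ⟨z, by rw [hz, CochainComplex.HomComplex.Cochain.ofHom_zero, add_zero]⟩
  choose z hz using hz
  let z' : CochainComplex.HomComplex.Cochain c.pt Y (-1) :=
    CochainComplex.HomComplex.Cochain.mk fun p q hpq ↦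
      (hc p).desc ⟨_, Discrete.natTrans fun j ↦ (z j).v p q hpq⟩
  have hz' (j) : (CochainComplex.HomComplex.Cochain.ofHom (c.ι.app j)).comp z' (zero_add _) =
      z j := by
    ext p q hpq
    rw [CochainComplex.HomComplex.Cochain.zero_cochain_comp_v,
      CochainComplex.HomComplex.Cochain.ofHom_v]
    exact (hc p).fac ⟨_, Discrete.natTrans fun j ↦ (z j).v p q hpq⟩ j
  rw [← Functor.map_zero DerivedCategory.Q]
  refine DerivedCategory.Q_map_eq_of_homotopy (C := C) (f := f) (g := 0)
    ((CochainComplex.HomComplex.Cochain.equivHomotopy _ _).symm ⟨z', ?_⟩)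
  ext p
  refine (hc p).hom_ext fun j ↦ ?_
  have := CochainComplex.HomComplex.Cochain.congr_v (hz j) p p (add_zero p)
  rw [← hz' j, CochainComplex.HomComplex.δ_ofHom_comp] at this
  rw [CochainComplex.HomComplex.Cochain.zero_cochain_comp_v,
    CochainComplex.HomComplex.Cochain.ofHom_v, CochainComplex.HomComplex.Cochain.ofHom_v] at this
  simpa using! this

open DerivedCategory in
/-- The localization functor from complexes to the derived category preserves exact coproducts:
both the existence and the uniqueness of a morphism out of the coproduct follow from the calculus
of fractions. -/
theorem DerivedCategory.preservesColimitsOfShape_Q [HasColimitsOfShape (Discrete J) C]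
    [HasExactColimitsOfShape (Discrete J) C] :
    PreservesColimitsOfShape (Discrete J) (Q : CochainComplex C ℤ ⥤ DerivedCategory C) where
  preservesColimit {F} := by
    let c := HomologicalComplex.coconeOfHasColimitEval F
    have hc : IsColimit c := HomologicalComplex.isColimitCoconeOfHasColimitEval F
    have hc' (n) : IsColimit ((HomologicalComplex.eval C _ n).mapCocone c) :=
      isColimitOfPreserves _ hc
    have exist (Y : CochainComplex C ℤ) (g : ∀ j, Q.obj (F.obj j) ⟶ Q.obj Y) :
        ∃ f : Q.obj c.pt ⟶ Q.obj Y, ∀ j, Q.map (c.ι.app j) ≫ f = g j := by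
      -- Write `g j` as `s j` inverted followed by `k j`; the coproduct of the `s j` can be inverted.
      choose X s hs k hk using fun j ↦ right_fac (g j)
      let φ : Discrete.functor (fun j : J ↦ X ⟨j⟩) ⟶ F := Discrete.natTrans fun j ↦ s j
      have hφ : QuasiIso ((HomologicalComplex.isColimitCoconeOfHasColimitEval _).map c φ) :=
        HomologicalComplex.quasiIso_map_of_hasExactColimitsOfShape φ
          fun j ↦ (isIso_Q_map_iff_quasiIso C (s j)).1 (hs j)
      refine ⟨inv (Q.map ((HomologicalComplex.isColimitCoconeOfHasColimitEval _).map c φ)) ≫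
        Q.map ((HomologicalComplex.isColimitCoconeOfHasColimitEval _).desc
          ⟨Y, Discrete.natTrans fun j ↦ k j⟩), fun j ↦ ?_⟩
      rw [hk, ← cancel_epi (Q.map (s j)), IsIso.hom_inv_id_assoc, ← Q.map_comp_assoc]
      have h1 : s j ≫ c.ι.app j = (HomologicalComplex.coconeOfHasColimitEval _).ι.app j ≫
          (HomologicalComplex.isColimitCoconeOfHasColimitEval _).map c φ :=
        (IsColimit.ι_map _ c φ j).symm
      rw [h1, Q.map_comp_assoc, IsIso.hom_inv_id_assoc, ← Q.map_comp]
      congr 1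
      exact (HomologicalComplex.isColimitCoconeOfHasColimitEval _).fac _ j
    have unique (Y : CochainComplex C ℤ) (f : Q.obj c.pt ⟶ Q.obj Y)
        (hf : ∀ j, Q.map (c.ι.app j) ≫ f = 0) : f = 0 := by
      obtain ⟨Y', g, s, hs, rfl⟩ := left_fac f
      have hg (j) : Q.map (c.ι.app j ≫ g) = 0 := by
        rw [← cancel_mono (inv (Q.map s)), Q.map_comp, Category.assoc, hf, zero_comp]
      -- A morphism of complexes that vanishes in the derived category is null-homotopic after
      -- composition with a quasi-isomorphism to its source.
      have hX (j) : ∃ (X : CochainComplex C ℤ) (t : X ⟶ F.obj j), QuasiIso t ∧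
          Nonempty (Homotopy (t ≫ c.ι.app j ≫ g) 0) := by
        have h1 : Qh.map ((HomotopyCategory.quotient _ _).map (c.ι.app j ≫ g)) = Qh.map 0 := by
          rw [← cancel_mono ((quotientCompQhIso C).hom.app _),
            quotientCompQhIso_hom_naturality, hg]
          simp
        obtain ⟨X, t, ht, h⟩ := (MorphismProperty.map_eq_iff_precomp Qh
          (HomotopyCategory.quasiIso C (ComplexShape.up ℤ)) _ _).1 h1
        obtain ⟨X, rfl⟩ := HomotopyCategory.quotient_obj_surjective X
        obtain ⟨t, rfl⟩ := (HomotopyCategory.quotient _ _).map_surjective t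
        refine ⟨X, t, ?_, ⟨HomotopyCategory.homotopyOfEq _ _ ?_⟩⟩
        · rw [← isIso_Qh_map_iff] at ht
          exact (isIso_Q_map_iff_quasiIso C t).1 ht
        · rw [Functor.map_comp, h]
          simp
      choose X t ht hh using hX
      let φ : Discrete.functor (fun j : J ↦ X ⟨j⟩) ⟶ F := Discrete.natTrans fun j ↦ t j
      let c' := HomologicalComplex.coconeOfHasColimitEval (Discrete.functor (fun j : J ↦ X ⟨j⟩))
      let Φ : c'.pt ⟶ c.pt := (HomologicalComplex.isColimitCoconeOfHasColimitEval _).map c φ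
      have hφ : QuasiIso Φ :=
        HomologicalComplex.quasiIso_map_of_hasExactColimitsOfShape φ ht
      have h2 : Q.map (Φ ≫ g) = 0 := by
        refine CochainComplex.Q_map_eq_zero_of_isColimit (c := c')
          (fun n ↦ isColimitOfPreserves _
            (HomologicalComplex.isColimitCoconeOfHasColimitEval _)) _ fun j ↦ ?_
        refine (Homotopy.ofEq ?_).trans (hh j).some
        rw [← Category.assoc, IsColimit.ι_map, Category.assoc]
        rfl
      rw [Q.map_comp] at h2
      rw [← cancel_epi (Q.map Φ), reassoc_of% h2]
      simp
    refine preservesColimit_of_preserves_colimit_cocone hc ?_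
    have exist' (s : Cocone (F ⋙ Q)) :
        ∃ f : Q.obj c.pt ⟶ s.pt, ∀ j, Q.map (c.ι.app j) ≫ f = s.ι.app j := by
      obtain ⟨f, hf⟩ := exist (Q.objPreimage s.pt)
        (fun j ↦ s.ι.app j ≫ (Q.objObjPreimageIso s.pt).inv)
      exact ⟨f ≫ (Q.objObjPreimageIso s.pt).hom, fun j ↦ by simp [reassoc_of% hf]⟩
    choose d hd using exist'
    exact
      { desc := d
        fac := hd
        uniq s m hm := by
          rw [← sub_eq_zero, ← cancel_mono (Q.objObjPreimageIso s.pt).inv, zero_comp]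
          refine unique _ _ fun j ↦ ?_
          have := hm j
          dsimp at this
          rw [Preadditive.sub_comp, Preadditive.comp_sub, ← Category.assoc, ← Category.assoc, hd,
            this, sub_self] }

variable {C₂ : Type u₂} [Category.{v₂} C₂] [Abelian C₂] [HasDerivedCategory.{w₂} C₂]
  (F : C ⥤ C₂) [F.Additive] [PreservesFiniteLimits F] [PreservesFiniteColimits F]

/-- The functor between derived categories induced by an exact functor that preserves (exact)
coproducts preserves coproducts. -/
theorem CategoryTheory.Functor.preservesColimitsOfShape_mapDerivedCategory
    [HasColimitsOfShape (Discrete J) C] [HasExactColimitsOfShape (Discrete J) C]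
    [HasColimitsOfShape (Discrete J) C₂] [HasExactColimitsOfShape (Discrete J) C₂]
    [PreservesColimitsOfShape (Discrete J) F] :
    PreservesColimitsOfShape (Discrete J) F.mapDerivedCategory where
  preservesColimit {K} := by
    have := DerivedCategory.preservesColimitsOfShape_Q (C := C) (J := J)
    have := DerivedCategory.preservesColimitsOfShape_Q (C := C₂) (J := J)
    have : PreservesColimitsOfShape (Discrete J)
        (F.mapHomologicalComplex (ComplexShape.up ℤ)) :=
      HomologicalComplex.preservesColimitsOfShape_of_eval _ fun i ↦
        inferInstanceAs (PreservesColimitsOfShape (Discrete J)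
          (HomologicalComplex.eval C (ComplexShape.up ℤ) i ⋙ F))
    have : PreservesColimitsOfShape (Discrete J) (DerivedCategory.Q ⋙ F.mapDerivedCategory) :=
      preservesColimitsOfShape_of_natIso F.mapDerivedCategoryFactors.symm
    let K' : Discrete J ⥤ CochainComplex C ℤ :=
      Discrete.functor fun j ↦ DerivedCategory.Q.objPreimage (K.obj ⟨j⟩)
    let e : K' ⋙ DerivedCategory.Q ≅ K :=
      Discrete.natIso fun j ↦ DerivedCategory.Q.objObjPreimageIso (K.obj j)
    have : PreservesColimit (K' ⋙ DerivedCategory.Q) F.mapDerivedCategory :=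
      preservesColimit_of_preserves_colimit_cocone
        (isColimitOfPreserves DerivedCategory.Q (colimit.isColimit K'))
        (isColimitOfPreserves (DerivedCategory.Q ⋙ F.mapDerivedCategory) (colimit.isColimit K'))
    exact preservesColimit_of_iso_diagram _ e

end Coproducts

/-! ### Localizing subcategories of derived categories -/

section Localizing
universe w₁ w₂ v₁ v₂ u₁ u₂ t

theorem generates_iff {T : Type v} [Category.{w} T] [HasZeroObject T] [Preadditive T]
    [HasShift T ℤ] [∀ n : ℤ, (shiftFunctor T n).Additive] [Pretriangulated T]
    {S : ObjectProperty T} : Generates.{w, v, u} S ↔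
      ∀ P : ObjectProperty T, IsLocalizing.{w, v, u} P → S ≤ P → ∀ X, P X := by
  refine ⟨fun h P hP hS X ↦ ?_, fun h ↦ eq_top_iff.2 fun X _ P hP hS ↦ h P hP hS X⟩
  have hX : Loc.{w, v, u} S X := by
    rw [show Loc.{w, v, u} S = ⊤ from h]
    trivial
  exact hX P hP hS

namespace IsLocalizing

theorem isClosedUnderIsomorphisms {T : Type v} [Category.{w} T] [HasZeroObject T] [Preadditive T]
    [HasShift T ℤ] [∀ n : ℤ, (shiftFunctor T n).Additive] [Pretriangulated T]
    {P : ObjectProperty T} (hP : IsLocalizing.{w, v, u} P) : P.IsClosedUnderIsomorphisms where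
  of_iso {X Y} e hX := by
    have := hP.closedUnderCoproducts PUnit
    refine P.prop_of_isColimit (F := Discrete.functor fun _ : PUnit.{u + 1} ↦ X)
      (c := Cofan.mk Y fun _ ↦ e.hom) ?_ fun _ ↦ hX
    exact Cofan.IsColimit.mk _ (fun s ↦ e.inv ≫ s.inj ⟨⟩) (by simp)
      fun s m hm ↦ by simp [← hm ⟨⟩]

variable {C : Type v} [Category.{u} C] [Abelian C] [HasDerivedCategory.{w} C]
  {P : ObjectProperty (DerivedCategory C)}

/-- Each object of finite injective dimension has a finite injective resolution, so it lies in
every localizing subcategory that contains the injective objects. -/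
theorem singleFunctor_of_hasInjectiveDimensionLT [EnoughInjectives C]
    (hP : IsLocalizing.{w, max u v, t} P) (hI : injectivesInDegreeZero C ≤ P) (n : ℕ) (X : C)
    [hX : HasInjectiveDimensionLT X n] : P ((DerivedCategory.singleFunctor C 0).obj X) := by
  have := hP.isTriangulated
  have := hP.isClosedUnderIsomorphisms
  have hinj (I : C) [Injective I] : P ((DerivedCategory.singleFunctor C 0).obj I) :=
    hI _ (ObjectProperty.prop_map_obj (isInjective C) _ ‹Injective I›)
  induction n generalizing X with
  | zero =>
    have := (isZero_of_hasInjectiveDimensionLT_zero X).injective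
    exact hinj X
  | succ n ih =>
    obtain _ | n := n
    · have := injective_iff_hasInjectiveDimensionLT_one.2 hX
      exact hinj X
    have hS : (ShortComplex.mk _ _ (cokernel.condition (Injective.ι X))).ShortExact :=
      { exact := ShortComplex.exact_cokernel _ }
    have h := (hS.hasInjectiveDimensionLT_X₃_iff n
      (inferInstanceAs (Injective (Injective.under X)))).2 hX
    exact P.ext_of_isTriangulatedClosed₁ _ hS.singleTriangle_distinguished (hinj _) (ih _)

theorem Q_X₂_of_shortExact (hP : IsLocalizing.{w, max u v, t} P)
    {S : ShortComplex (CochainComplex C ℤ)} (hS : S.ShortExact)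
    (h₁ : P (DerivedCategory.Q.obj S.X₁)) (h₃ : P (DerivedCategory.Q.obj S.X₃)) :
    P (DerivedCategory.Q.obj S.X₂) := by
  have := hP.isTriangulated
  have := hP.isClosedUnderIsomorphisms
  exact P.ext_of_isTriangulatedClosed₂ _ (DerivedCategory.triangleOfSES_distinguished hS) h₁ h₃

variable {D : Type v} [Category.{u} D] [Abelian D] [HasDerivedCategory.{w} D]
  (F : D ⥤ C) [F.Additive] [PreservesFiniteLimits F] [PreservesFiniteColimits F]

theorem inverseImage_mapDerivedCategory [HasCoproducts.{t} C] [AB4OfSize.{t} C]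
    [HasCoproducts.{t} D] [AB4OfSize.{t} D] [∀ J : Type t, PreservesColimitsOfShape (Discrete J) F]
    (hP : IsLocalizing.{w, max u v, t} P) :
    IsLocalizing.{w, max u v, t} (P.inverseImage F.mapDerivedCategory) where
  isTriangulated := by
    have := hP.isTriangulated
    have := hP.isClosedUnderIsomorphisms
    infer_instance
  closedUnderCoproducts J := by
    have := hP.closedUnderCoproducts J
    have := F.preservesColimitsOfShape_mapDerivedCategory (J := J)
    infer_instance

/-- If the injective objects of `D` generate its derived category and an exact functor `F` takes
them to objects of finite injective dimension, then the functor induced by `F` takes all of the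
derived category into every localizing subcategory that contains the injective objects. -/
theorem mapDerivedCategory_obj [EnoughInjectives C] [HasCoproducts.{t} C] [AB4OfSize.{t} C]
    [HasCoproducts.{t} D] [AB4OfSize.{t} D] [∀ J : Type t, PreservesColimitsOfShape (Discrete J) F]
    (hP : IsLocalizing.{w, max u v, t} P) (hI : injectivesInDegreeZero C ≤ P)
    (hF : ∀ I : D, Injective I → ∃ n, HasInjectiveDimensionLT (F.obj I) n)
    (hD : Generates.{w, max u v, t} (injectivesInDegreeZero D)) (K : CochainComplex D ℤ) :
    P (DerivedCategory.Q.obj ((F.mapHomologicalComplex _).obj K)) := by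
  have := hP.isClosedUnderIsomorphisms
  refine P.prop_of_iso (F.mapDerivedCategoryFactors.app K)
    (generates_iff.1 hD _ (hP.inverseImage_mapDerivedCategory F) (fun X hX ↦ ?_) _)
  obtain ⟨I, hI', ⟨e⟩⟩ := hX
  obtain ⟨n, hn⟩ := hF I hI'
  exact P.prop_of_iso (((F.mapDerivedCategorySingleFunctor 0).app I).symm ≪≫
    F.mapDerivedCategory.mapIso e) (hP.singleFunctor_of_hasInjectiveDimensionLT hI n (F.obj I))

end IsLocalizing

end Localizing

/-! ### The right module of additive maps out of a left module -/

/-- For a left `R`-module `L` and an abelian group `D`, the abelian group of additive maps from `L`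
to `D`, viewed as a right `R`-module by `(φ r) x = φ (r x)`. -/
def RightDual (R L D : Type u) [Ring R] [AddCommGroup L] [Module R L] [AddCommGroup D] : Type u :=
  L →+ D

namespace RightDual

variable {R L L' D : Type u} [Ring R] [AddCommGroup L] [Module R L] [AddCommGroup L'] [Module R L']
  [AddCommGroup D]

instance : AddCommGroup (RightDual R L D) := inferInstanceAs (AddCommGroup (L →+ D))

instance : FunLike (RightDual R L D) L D := inferInstanceAs (FunLike (L →+ D) L D)

instance : AddMonoidHomClass (RightDual R L D) L D :=
  inferInstanceAs (AddMonoidHomClass (L →+ D) L D)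

@[ext] theorem ext {φ ψ : RightDual R L D} (h : ∀ x, φ x = ψ x) : φ = ψ := DFunLike.ext _ _ h

@[simp] theorem add_apply (φ ψ : RightDual R L D) (x : L) : (φ + ψ) x = φ x + ψ x := rfl

@[simp] theorem zero_apply (x : L) : (0 : RightDual R L D) x = 0 := rfl

instance : SMul Rᵐᵒᵖ (RightDual R L D) :=
  ⟨fun r φ ↦ AddMonoidHom.comp (M := L) (N := L) (P := D) φ (DistribSMul.toAddMonoidHom L r.unop)⟩

@[simp] theorem smul_apply (r : Rᵐᵒᵖ) (φ : RightDual R L D) (x : L) :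
    (r • φ) x = φ (r.unop • x) := rfl

instance : Module Rᵐᵒᵖ (RightDual R L D) where
  one_smul φ := by ext; simp
  mul_smul r s φ := by ext; simp [mul_smul]
  smul_zero r := by ext; simp
  smul_add r φ ψ := by ext; simp
  add_smul r s φ := by ext; simp [add_smul]
  zero_smul φ := by ext; simp

/-- An additive map out of a left `R`-module, as an element of the right module `RightDual`. -/
def of (φ : L →+ D) : RightDual R L D := φ

@[simp] theorem of_apply (φ : L →+ D) (x : L) : (of φ : RightDual R L D) x = φ x := rfl

/-- The map of right modules given by precomposition with a map of left modules. -/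
def map (D : Type u) [AddCommGroup D] (f : L →ₗ[R] L') :
    RightDual R L' D →ₗ[Rᵐᵒᵖ] RightDual R L D where
  toFun φ := of (AddMonoidHom.comp (M := L) (N := L') (P := D) φ f.toAddMonoidHom)
  map_add' _ _ := rfl
  map_smul' r φ := ext fun x ↦ congr_arg φ (f.map_smul r.unop x).symm

@[simp] theorem map_apply (f : L →ₗ[R] L') (φ : RightDual R L' D) (x : L) :
    map D f φ x = φ (f x) := rfl

theorem map_injective {f : L →ₗ[R] L'} (hf : Function.Surjective f) :
    Function.Injective (map D f) := by
  intro φ ψ h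
  ext x
  obtain ⟨x, rfl⟩ := hf x
  exact DFunLike.congr_fun h x

theorem exact_map {L'' : Type u} [AddCommGroup L''] [Module R L''] {f : L →ₗ[R] L'}
    {g : L' →ₗ[R] L''} (h : Function.Exact f g) (hg : Function.Surjective g) :
    Function.Exact (map D g) (map D f) := by
  intro φ
  constructor
  · intro hφ
    have hker : g.toAddMonoidHom.ker ≤ AddMonoidHom.ker (G := L') (M := D) φ := by
      intro x hx
      obtain ⟨y, rfl⟩ := (h x).1 hx
      exact DFunLike.congr_fun hφ y
    exact ⟨of (AddMonoidHom.liftOfSurjective g.toAddMonoidHom hg ⟨φ, hker⟩), ext fun x ↦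
      AddMonoidHom.liftOfRightInverse_comp_apply _ _ (Function.rightInverse_surjInv hg) _ x⟩
  · rintro ⟨ψ, rfl⟩
    ext x
    simp [h.apply_apply_eq_zero]

theorem ext_finsupp {S : Type u} {φ ψ : RightDual R (S →₀ R) D}
    (h : ∀ s r, φ (Finsupp.single s r) = ψ (Finsupp.single s r)) : φ = ψ :=
  Finsupp.addHom_ext (f := (show (S →₀ R) →+ D from φ)) h

end RightDual

/-- An additive map into an injective abelian group extends along an injective additive map. -/
theorem AddMonoidHom.exists_extension {X Y D : Type u} [AddCommGroup X] [AddCommGroup Y]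
    [AddCommGroup D] [Injective (AddCommGrpCat.of D)] {f : X →+ Y} (hf : Function.Injective f)
    (g : X →+ D) : ∃ h : Y →+ D, ∀ x, h (f x) = g x := by
  have : Mono (AddCommGrpCat.ofHom f) := (AddCommGrpCat.mono_iff_injective _).2 hf
  refine ⟨(Injective.factorThru (AddCommGrpCat.ofHom g) (AddCommGrpCat.ofHom f)).hom, fun x ↦ ?_⟩
  exact ConcreteCategory.congr_hom
    (Injective.comp_factorThru (AddCommGrpCat.ofHom g) (AddCommGrpCat.ofHom f)) x

namespace RightDual

variable {R : Type u} [Ring R] (D : Type u) [AddCommGroup D] [Injective (AddCommGrpCat.of D)]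

theorem map_surjective {L L' : Type u} [AddCommGroup L] [Module R L] [AddCommGroup L'] [Module R L']
    {f : L →ₗ[R] L'} (hf : Function.Injective f) : Function.Surjective (map D f) := by
  intro φ
  obtain ⟨ψ, hψ⟩ := AddMonoidHom.exists_extension (D := D) (f := f.toAddMonoidHom) hf φ
  exact ⟨of ψ, ext hψ⟩

/-- A map from a right module `X` to the dual of the free module on `S` amounts to a family indexed
by `S` of additive maps `X → D`, and these extend along injections. -/
instance injective_finsupp (S : Type u) :
    Injective (ModuleCat.of Rᵐᵒᵖ (RightDual R (S →₀ R) D)) where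
  factors {X Y} g f _ := by
    let g' : X →ₗ[Rᵐᵒᵖ] RightDual R (S →₀ R) D := g.hom
    let k₀ (s : S) : X →+ D :=
      { toFun x := g' x (Finsupp.single s 1)
        map_zero' := by simp
        map_add' x y := by simp }
    choose k hk using fun s ↦ AddMonoidHom.exists_extension (f := f.hom.toAddMonoidHom)
      ((ModuleCat.mono_iff_injective f).1 inferInstance) (k₀ s)
    let h₀ (y : Y) : RightDual R (S →₀ R) D :=
      of (Finsupp.liftAddHom fun s ↦ (k s).comp
        { toFun r := op r • y
          map_zero' := by simp
          map_add' := by simp [add_smul] })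
    have hh₀ (y : Y) (s : S) (r : R) : h₀ y (Finsupp.single s r) = k s (op r • y) :=
      Finsupp.liftAddHom_apply_single _ s r
    let h : Y →ₗ[Rᵐᵒᵖ] RightDual R (S →₀ R) D :=
      { toFun := h₀
        map_add' y z := ext_finsupp fun s r ↦ by
          rw [add_apply, hh₀, hh₀, hh₀, smul_add, map_add]
        map_smul' r y := ext_finsupp fun s t ↦ by
          rw [RingHom.id_apply, smul_apply, Finsupp.smul_single, hh₀, hh₀, smul_smul]
          rfl }
    have hfg (x : X) : h₀ (f.hom x) = g' x := ext_finsupp fun s r ↦ by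
      rw [hh₀, ← map_smul]
      refine (hk s _).trans ?_
      change g' (op r • x) (Finsupp.single s 1) = _
      rw [map_smul, smul_apply, Finsupp.smul_single, unop_op, smul_eq_mul, mul_one]
    exact ⟨ModuleCat.ofHom h, ModuleCat.hom_ext (LinearMap.ext hfg)⟩

instance injective_of_projective (L : ModuleCat.{u} R) [Projective L] :
    Injective (ModuleCat.of Rᵐᵒᵖ (RightDual R L D)) := by
  have : Module.Projective R L := (IsProjective.iff_projective L).2 inferInstance
  obtain ⟨s, hs⟩ := Module.projective_def'.1 this
  have r : Retract (ModuleCat.of Rᵐᵒᵖ (RightDual R L D))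
      (ModuleCat.of Rᵐᵒᵖ (RightDual R (L →₀ R) D)) :=
    { i := ModuleCat.ofHom (map D (Finsupp.linearCombination R id))
      r := ModuleCat.ofHom (map D s)
      retract := by
        ext φ
        refine RightDual.ext fun x ↦ congr_arg φ (LinearMap.congr_fun hs x) }
  have := r.hasInjectiveDimensionLT 1
  infer_instance

/-- Since `D` is injective, additive maps into `D` turn short exact sequences of left modules into
short exact sequences of right modules. -/
theorem shortExact {S : ShortComplex (ModuleCat.{u} R)} (hS : S.ShortExact) :
    (ShortComplex.mk (ModuleCat.ofHom (map D S.g.hom)) (ModuleCat.ofHom (map D S.f.hom))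
      (ModuleCat.hom_ext ((exact_map (D := D)
        ((ShortComplex.ShortExact.moduleCat_exact_iff_function_exact S).1 hS.exact)
        ((ModuleCat.epi_iff_surjective S.g).1 hS.epi_g)).linearMap_comp_eq_zero))).ShortExact where
  mono_f := (ModuleCat.mono_iff_injective _).2
    (map_injective ((ModuleCat.epi_iff_surjective S.g).1 hS.epi_g))
  epi_g := (ModuleCat.epi_iff_surjective _).2
    (map_surjective D ((ModuleCat.mono_iff_injective S.f).1 hS.mono_f))
  exact := (ShortComplex.ShortExact.moduleCat_exact_iff_function_exact _).2
    (exact_map ((ShortComplex.ShortExact.moduleCat_exact_iff_function_exact S).1 hS.exact)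
      ((ModuleCat.epi_iff_surjective S.g).1 hS.epi_g))

/-- The dual of a projective resolution of length `n` is an injective resolution of length `n`. -/
theorem hasInjectiveDimensionLT (n : ℕ) (L : ModuleCat.{u} R) [hL : HasProjectiveDimensionLT L n] :
    HasInjectiveDimensionLT (ModuleCat.of Rᵐᵒᵖ (RightDual R L D)) n := by
  induction n generalizing L with
  | zero =>
    have := ModuleCat.subsingleton_of_isZero (isZero_of_hasProjectiveDimensionLT_zero L)
    have : Subsingleton (RightDual R L D) :=
      ⟨fun φ ψ ↦ RightDual.ext fun x ↦ by rw [Subsingleton.elim x 0, map_zero, map_zero]⟩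
    exact (ModuleCat.isZero_of_subsingleton _).hasInjectiveDimensionLT_zero
  | succ n ih =>
    obtain _ | n := n
    · have := projective_iff_hasProjectiveDimensionLT_one.2 hL
      infer_instance
    have hS : (ShortComplex.mk _ _ (kernel.condition (Projective.π L))).ShortExact :=
      { exact := ShortComplex.exact_kernel _ }
    have h := (hS.hasProjectiveDimensionLT_X₃_iff n
      (inferInstanceAs (Projective (Projective.over L)))).1 hL
    exact (shortExact D hS).hasInjectiveDimensionLT_X₁ (n + 1) (ih _) inferInstance

end RightDual

/-- Each injective right `R`-module `I` is a retract of a right module of additive maps `R → D`: it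
embeds there by `x ↦ (r ↦ x r)`, where `D` is an injective abelian group that contains `I`. -/
theorem ModuleCat.exists_retract_rightDual {R : Type u} [Ring R] (I : ModuleCat.{u} Rᵐᵒᵖ)
    [Injective I] : ∃ (D : AddCommGrpCat.{u}) (_ : Injective D),
      Nonempty (Retract I (ModuleCat.of Rᵐᵒᵖ (RightDual R R D))) := by
  let j := Injective.ι (AddCommGrpCat.of I)
  let f : I →ₗ[Rᵐᵒᵖ] RightDual R R (Injective.under (AddCommGrpCat.of I) : AddCommGrpCat.{u}) :=
    { toFun x := RightDual.of (j.hom.comp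
        { toFun r := op r • x
          map_zero' := by simp
          map_add' := by simp [add_smul] })
      map_add' x y := by ext; simp
      map_smul' r x := by ext; simp [mul_smul] }
  have hf : Function.Injective f := by
    intro x y h
    have := DFunLike.congr_fun (F := RightDual R R _) h 1
    refine (AddCommGrpCat.mono_iff_injective j).1 inferInstance ?_
    simpa [f] using this
  have : Mono (ModuleCat.ofHom f) := (ModuleCat.mono_iff_injective _).2 hf
  exact ⟨_, inferInstance,
    ⟨⟨ModuleCat.ofHom f, Injective.factorThru (𝟙 I) (ModuleCat.ofHom f), by simp⟩⟩⟩

/-! ### Transfer of injective generation along an exact functor -/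

theorem injectivesGenerate_iff {R : Type u} [Ring R] : InjectivesGenerate R ↔
    letI := HasDerivedCategory.standard (ModuleCat.{u} Rᵐᵒᵖ)
    ∀ P : ObjectProperty (DerivedCategory (ModuleCat.{u} Rᵐᵒᵖ)), IsLocalizing.{_, _, u} P →
      injectivesInDegreeZero (ModuleCat.{u} Rᵐᵒᵖ) ≤ P →
        ∀ K : CochainComplex (ModuleCat.{u} Rᵐᵒᵖ) ℤ, P (DerivedCategory.Q.obj K) := by
  let := HasDerivedCategory.standard (ModuleCat.{u} Rᵐᵒᵖ)
  refine generates_iff.trans ⟨fun h P hP hI K ↦ h P hP hI _, fun h P hP hI X ↦ ?_⟩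
  have := hP.isClosedUnderIsomorphisms
  exact P.prop_of_iso (DerivedCategory.Q.objObjPreimageIso X) (h P hP hI _)

/-- If an exact, coproduct-preserving and (split) essentially surjective functor takes injective
modules to modules of finite injective dimension, then injective generation passes from its source
to its target. -/
theorem InjectivesGenerate.of_functor {R S : Type u} [Ring R] [Ring S]
    (F : ModuleCat.{u} Rᵐᵒᵖ ⥤ ModuleCat.{u} Sᵐᵒᵖ) [F.Additive] [PreservesFiniteLimits F]
    [PreservesFiniteColimits F] [∀ J : Type u, PreservesColimitsOfShape (Discrete J) F]
    (G : ModuleCat.{u} Sᵐᵒᵖ ⥤ ModuleCat.{u} Rᵐᵒᵖ) [G.Additive] (e : G ⋙ F ≅ 𝟭 _)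
    (hF : ∀ I : ModuleCat.{u} Rᵐᵒᵖ, Injective I → ∃ n, HasInjectiveDimensionLT (F.obj I) n)
    (hR : InjectivesGenerate R) : InjectivesGenerate S := by
  let := HasDerivedCategory.standard (ModuleCat.{u} Rᵐᵒᵖ)
  let := HasDerivedCategory.standard (ModuleCat.{u} Sᵐᵒᵖ)
  refine injectivesGenerate_iff.2 fun P hP hI K ↦ ?_
  have := hP.isClosedUnderIsomorphisms
  have e' : (F.mapHomologicalComplex _).obj ((G.mapHomologicalComplex _).obj K) ≅ K :=
    HomologicalComplex.Hom.isoOfComponents (fun n ↦ e.app (K.X n))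
      fun n m _ ↦ (e.hom.naturality (K.d n m)).symm
  exact P.prop_of_iso (DerivedCategory.Q.mapIso e') (hP.mapDerivedCategory_obj F hI hF hR _)

/-! ### Restriction of scalars and injective generation -/

namespace ModuleCat

variable {R S : Type u} [Ring R] [Ring S] (f : R →+* S)

theorem exact_map_restrictScalars (T : ShortComplex (ModuleCat.{u} S)) (hT : T.Exact) :
    (T.map (restrictScalars.{u} f)).Exact := by
  rw [ShortComplex.ShortExact.moduleCat_exact_iff_function_exact] at hT ⊢
  exact hT

instance : PreservesFiniteLimits (restrictScalars.{u} f)  := by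
  have := ((restrictScalars.{u} f).exact_tfae.out 1 3).1 (exact_map_restrictScalars f)
  exact this.1

instance : PreservesFiniteColimits (restrictScalars.{u} f)  := by
  have := ((restrictScalars.{u} f).exact_tfae.out 1 3).1 (exact_map_restrictScalars f)
  exact this.2

end ModuleCat

theorem InjectivesGenerate.of_ringEquiv {R S : Type u} [Ring R] [Ring S] (e : S ≃+* R)
    (hR : InjectivesGenerate R) : InjectivesGenerate S := by
  let E := ModuleCat.restrictScalarsEquivalenceOfRingEquiv (RingEquiv.op e)
  refine .of_functor (ModuleCat.restrictScalars (RingEquiv.op e).toRingHom) E.inverse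
    E.counitIso (fun I hI ↦ ⟨1, ?_⟩) hR
  have : Injective ((ModuleCat.restrictScalars (RingEquiv.op e).toRingHom).obj I) :=
    E.symm.toAdjunction.map_injective I hI
  infer_instance

/-- If `S` has finite projective dimension as a left `R`-module, then an injective right `S`-module
has finite injective dimension as a right `R`-module, because this holds for `Hom_ℤ(S, D)`. -/
theorem ModuleCat.hasInjectiveDimensionLT_restrictScalars {R S : Type u} [Ring R] [Ring S]
    (f : R →+* S) (n : ℕ)
    [HasProjectiveDimensionLT ((ModuleCat.restrictScalars f).obj (ModuleCat.of S S)) n]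
    (I : ModuleCat.{u} Sᵐᵒᵖ) [Injective I] :
    HasInjectiveDimensionLT ((ModuleCat.restrictScalars (RingHom.op f)).obj I) n := by
  obtain ⟨D, _, ⟨r⟩⟩ := I.exists_retract_rightDual
  let L := (ModuleCat.restrictScalars f).obj (ModuleCat.of S S)
  let e : (ModuleCat.restrictScalars (RingHom.op f)).obj
      (ModuleCat.of Sᵐᵒᵖ (RightDual S S D)) ≃ₗ[Rᵐᵒᵖ] RightDual R L D :=
    { AddEquiv.refl (S →+ D) with
      map_smul' _ _ := rfl }
  have := RightDual.hasInjectiveDimensionLT D n L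
  have := hasInjectiveDimensionLT_of_iso e.symm.toModuleIso n
  exact (r.map (ModuleCat.restrictScalars (RingHom.op f))).hasInjectiveDimensionLT n

/-! ### Restriction of scalars along a non-unital ring homomorphism -/

theorem CategoryTheory.Retract.preservesColimit {C D J : Type*} [Category* C] [Category* D]
    [Category* J] {F G : C ⥤ D} (h : Retract F G) (K : J ⥤ C) [PreservesColimit K G] :
    PreservesColimit K F where
  preserves {c} hc := ⟨by
    let hG := isColimitOfPreserves G hc
    have w (X : C) : h.i.app X ≫ h.r.app X = 𝟙 _ := NatTrans.congr_app h.retract X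
    exact
      { desc s := h.i.app c.pt ≫ hG.desc ⟨s.pt, Functor.whiskerLeft K h.r ≫ s.ι⟩
        fac s j := by
          have := hG.fac ⟨s.pt, Functor.whiskerLeft K h.r ≫ s.ι⟩ j
          dsimp at this ⊢
          rw [NatTrans.naturality_assoc, this, reassoc_of% w]
        uniq s m hm := by
          refine Eq.trans (b := h.i.app c.pt ≫ h.r.app c.pt ≫ m)
            (by rw [← Category.assoc, w]; exact (Category.id_comp m).symm) ?_
          congr 1
          refine hG.hom_ext fun j ↦ ?_
          rw [hG.fac]
          exact (h.r.naturality_assoc _ _).trans (congr_arg (h.r.app (K.obj j) ≫ ·) (hm j)) }⟩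

theorem CategoryTheory.Retract.preservesLimit {C D J : Type*} [Category* C] [Category* D]
    [Category* J] {F G : C ⥤ D} (h : Retract F G) (K : J ⥤ C) [PreservesLimit K G] :
    PreservesLimit K F where
  preserves {c} hc := ⟨by
    let hG := isLimitOfPreserves G hc
    have w (X : C) : h.i.app X ≫ h.r.app X = 𝟙 _ := NatTrans.congr_app h.retract X
    exact
      { lift s := hG.lift ⟨s.pt, s.π ≫ Functor.whiskerLeft K h.i⟩ ≫ h.r.app c.pt
        fac s j := by
          have := hG.fac ⟨s.pt, s.π ≫ Functor.whiskerLeft K h.i⟩ j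
          dsimp at this ⊢
          rw [Category.assoc, ← NatTrans.naturality, reassoc_of% this, w, Category.comp_id]
        uniq s m hm := by
          refine Eq.trans (b := (m ≫ h.i.app c.pt) ≫ h.r.app c.pt)
            (by rw [Category.assoc, w]; exact (Category.comp_id m).symm) ?_
          congr 1
          refine hG.hom_ext fun j ↦ ?_
          rw [hG.fac, Category.assoc]
          exact (congr_arg (m ≫ ·) (h.i.naturality _).symm).trans ((Category.assoc _ _ _).symm.trans
            (congr_arg (· ≫ h.i.app (K.obj j)) (hm j))) }⟩

namespace ModuleCat

variable {R S : Type u} [Ring R] [Ring S] (f : S →ₙ+* R)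

/-- The part `e X` of an `R`-module `X` cut out by the idempotent `e = f 1`, where `f : S → R` is a
ring homomorphism that need not preserve the unit. It is an `S`-module. -/
def Corner (X : ModuleCat.{u} R) : AddSubgroup X where
  carrier := {x | f 1 • x = x}
  zero_mem' := smul_zero _
  add_mem' {x y} hx hy := by
    change f 1 • x = x at hx
    change f 1 • y = y at hy
    change f 1 • (x + y) = x + y
    rw [smul_add, hx, hy]
  neg_mem' {x} hx := by
    change f 1 • x = x at hx
    change f 1 • -x = -x
    rw [smul_neg, hx]

namespace Corner

variable {f} {X : ModuleCat.{u} R}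

theorem smul_mem (s : S) (x : X) : f s • x ∈ Corner f X := by
  change f 1 • f s • x = f s • x
  rw [smul_smul, ← map_mul, one_mul]

theorem one_smul (x : Corner f X) : f 1 • (x : X) = x := x.2

instance : SMul S (Corner f X) := ⟨fun s x ↦ ⟨f s • (x : X), smul_mem s _⟩⟩

@[simp] theorem coe_smul (s : S) (x : Corner f X) : ((s • x : Corner f X) : X) = f s • (x : X) :=
  rfl

instance : Module S (Corner f X) where
  one_smul x := Subtype.ext (one_smul x)
  mul_smul s t x := Subtype.ext (by simp [mul_smul])
  smul_zero s := Subtype.ext (by simp)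
  smul_add s x y := Subtype.ext (by simp)
  add_smul s t x := Subtype.ext (by simp [add_smul])
  zero_smul x := Subtype.ext (by simp)

end Corner

/-- The functor `X ↦ e X` from `R`-modules to `S`-modules, where `e = f 1` and `f : S → R` is a ring
homomorphism that need not preserve the unit. -/
def corner : ModuleCat.{u} R ⥤ ModuleCat.{u} S where
  obj X := ModuleCat.of S (Corner f X)
  map {X Y} g := ModuleCat.ofHom
    { toFun x := ⟨g.hom x, by
        change f 1 • g.hom x = g.hom x
        rw [← map_smul, Corner.one_smul]⟩
      map_add' x y := Subtype.ext (map_add g.hom _ _)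
      map_smul' s x := Subtype.ext (map_smul g.hom _ _) }

instance : (corner f).Additive where
  map_add := rfl

/-- On underlying abelian groups, `X ↦ e X` is a retract of the identity. -/
def cornerRetract : Retract (corner f ⋙ forget₂ (ModuleCat.{u} S) AddCommGrpCat.{u})
    (forget₂ (ModuleCat.{u} R) AddCommGrpCat.{u}) where
  i := { app X := AddCommGrpCat.ofHom (Corner f X).subtype }
  r :=
    { app X := AddCommGrpCat.ofHom
        { toFun x := ⟨f 1 • x, Corner.smul_mem 1 x⟩
          map_zero' := Subtype.ext (smul_zero _)
          map_add' x y := Subtype.ext (smul_add _ x y) }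
      naturality X Y g := by
        ext x
        exact Subtype.ext (map_smul g.hom (f 1) (show X from x)).symm }
  retract := by
    ext X x
    exact Subtype.ext (Corner.one_smul x)

theorem preservesLimitsOfShape_corner (J : Type u) [SmallCategory J] :
    PreservesLimitsOfShape J (corner f) where
  preservesLimit {K} := by
    have : PreservesLimit K (corner f ⋙ forget₂ (ModuleCat.{u} S) AddCommGrpCat.{u}) :=
      (cornerRetract f).preservesLimit K
    exact preservesLimit_of_reflects_of_preserves (corner f)
      (forget₂ (ModuleCat.{u} S) AddCommGrpCat.{u})

instance preservesColimitsOfShape_corner (J : Type u) [SmallCategory J] :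
    PreservesColimitsOfShape J (corner f) where
  preservesColimit {K} := by
    have : PreservesColimit K (corner f ⋙ forget₂ (ModuleCat.{u} S) AddCommGrpCat.{u}) :=
      (cornerRetract f).preservesColimit K
    exact preservesColimit_of_reflects_of_preserves (corner f)
      (forget₂ (ModuleCat.{u} S) AddCommGrpCat.{u})

instance : PreservesFiniteLimits (corner f) :=
  have : PreservesLimits (corner f) := ⟨fun {J} _ ↦ preservesLimitsOfShape_corner f J⟩
  inferInstance

instance : PreservesFiniteColimits (corner f) :=
  have : PreservesColimits (corner f) := ⟨fun {J} _ ↦ preservesColimitsOfShape_corner f J⟩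
  inferInstance

end ModuleCat

/-! ### The corners of a Morita context ring -/

namespace MoritaRing

section Corner

variable (A N M B : Type u) [Ring A] [Ring B] [AddCommGroup N] [AddCommGroup M]
  [Module A N] [Module Bᵐᵒᵖ N] [SMulCommClass A Bᵐᵒᵖ N]
  [Module B M] [Module Aᵐᵒᵖ M] [SMulCommClass B Aᵐᵒᵖ M]

/-- The non-unital ring homomorphism `a ↦ (a 0; 0 0)`. -/
@[simps]
def ofA : A →ₙ+* MoritaRing A N M B where
  toFun a := ⟨a, 0, 0, 0⟩
  map_zero' := rfl
  map_add' _ _ := by ext <;> simp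
  map_mul' _ _ := by ext <;> simp

/-- Exchange of the two diagonal entries and of the two off-diagonal entries. -/
def swap : MoritaRing A N M B ≃+* MoritaRing B M N A where
  toFun x := ⟨x.b, x.m, x.n, x.a⟩
  invFun x := ⟨x.b, x.m, x.n, x.a⟩
  left_inv _ := rfl
  right_inv _ := rfl
  map_add' _ _ := rfl
  map_mul' _ _ := by ext <;> simp [add_comm]

/-- The functor `X ↦ X e` from right modules over the Morita context ring to right `A`-modules,
where `e = (1 0; 0 0)`. -/
noncomputable abbrev cornerA :
    ModuleCat.{u} (MoritaRing A N M B)ᵐᵒᵖ ⥤ ModuleCat.{u} Aᵐᵒᵖ :=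
  ModuleCat.corner (NonUnitalRingHom.op (ofA A N M B))

/-- A right `A`-module, viewed as a right module over the Morita context ring by way of `toA`, is
recovered as its corner. -/
noncomputable def restrictScalarsCompCornerA :
    ModuleCat.restrictScalars (RingHom.op (toA A N M B)) ⋙ cornerA A N M B ≅ 𝟭 _ :=
  NatIso.ofComponents (fun X ↦ LinearEquiv.toModuleIso (R := Aᵐᵒᵖ) (X₁ := ModuleCat.Corner
      (NonUnitalRingHom.op (ofA A N M B))
      ((ModuleCat.restrictScalars (RingHom.op (toA A N M B))).obj X)) (X₂ := X)
    { toFun x := x.1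
      invFun x := ⟨x, one_smul Aᵐᵒᵖ (show X from x)⟩
      left_inv _ := rfl
      right_inv _ := rfl
      map_add' _ _ := rfl
      map_smul' _ _ := rfl }) (fun _ ↦ rfl)

/-- With `Λ` the Morita context ring and `e = (1 0; 0 0)`, the corner of `Hom_ℤ(Λ, D)` consists of
the additive maps out of the left `A`-module `e Λ = A × N`. -/
def cornerRightDualEquiv (D : Type u) [AddCommGroup D] :
    (cornerA A N M B).obj (ModuleCat.of (MoritaRing A N M B)ᵐᵒᵖ
      (RightDual (MoritaRing A N M B) (MoritaRing A N M B) D)) ≃ₗ[Aᵐᵒᵖ] RightDual A (A × N) D where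
  toFun φ := RightDual.of (AddMonoidHom.comp (M := A × N) (N := MoritaRing A N M B) (P := D) φ.1
    { toFun p := ⟨p.1, p.2, 0, 0⟩
      map_zero' := rfl
      map_add' _ _ := by ext <;> simp })
  invFun ψ := ⟨RightDual.of (AddMonoidHom.comp (M := MoritaRing A N M B) (N := A × N) (P := D) ψ
    { toFun x := (x.a, x.n)
      map_zero' := rfl
      map_add' _ _ := rfl }),
    RightDual.ext (R := MoritaRing A N M B) (L := MoritaRing A N M B) fun x ↦ congr_arg ψ (by simp)⟩
  left_inv φ := Subtype.ext (RightDual.ext (R := MoritaRing A N M B) fun x ↦ by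
    refine Eq.trans ?_ (DFunLike.congr_fun
      (F := RightDual (MoritaRing A N M B) (MoritaRing A N M B) D) φ.2 x)
    refine congr_arg (show RightDual (MoritaRing A N M B) (MoritaRing A N M B) D from φ.1) ?_
    ext <;> simp)
  right_inv ψ := rfl
  map_add' _ _ := rfl
  map_smul' a φ := RightDual.ext fun p ↦ congr_arg
    (show RightDual (MoritaRing A N M B) (MoritaRing A N M B) D from φ.1) (by ext <;> simp)

variable {A N M B}

/-- The bound is that for the dual of `A × N`, in which the summand `A` is projective. -/
theorem hasInjectiveDimensionLT_cornerA (n : ℕ) [HasProjectiveDimensionLT (ModuleCat.of A N) n]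
    (I : ModuleCat.{u} (MoritaRing A N M B)ᵐᵒᵖ) [Injective I] :
    HasInjectiveDimensionLT ((cornerA A N M B).obj I) (n + 1) := by
  obtain ⟨D, _, ⟨r⟩⟩ := I.exists_retract_rightDual
  have : HasProjectiveDimensionLT (ModuleCat.of A A) (n + 1) :=
    hasProjectiveDimensionLT_of_ge _ 1 (n + 1) (by lia)
  have : HasProjectiveDimensionLT (ModuleCat.of A N) (n + 1) :=
    hasProjectiveDimensionLT_of_ge _ n (n + 1) (by lia)
  have := hasProjectiveDimensionLT_of_iso
    (ModuleCat.biprodIsoProd (ModuleCat.of A A) (ModuleCat.of A N)) (n + 1)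
  have : HasInjectiveDimensionLT (ModuleCat.of Aᵐᵒᵖ (RightDual A (A × N) D)) (n + 1) :=
    RightDual.hasInjectiveDimensionLT D (n + 1) (ModuleCat.of A (A × N))
  have := hasInjectiveDimensionLT_of_iso (cornerRightDualEquiv A N M B D).symm.toModuleIso (n + 1)
  exact (r.map (cornerA A N M B)).hasInjectiveDimensionLT (n + 1)

theorem exists_hasProjectiveDimensionLT_of_lt_top {C : Type*} [Category* C] [Abelian C] {X : C}
    (h : projectiveDimension X < ⊤) : ∃ n, HasProjectiveDimensionLT X n := by
  obtain ⟨n, hn⟩ := (projectiveDimension_ne_top_iff X).1 h.ne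
  exact ⟨n + 1, hn⟩

/-- Injective generation descends to `A`, along the functor that takes a right module over the
Morita context ring to its corner. -/
theorem injectivesGenerate_left (h : projectiveDimension (ModuleCat.of A N) < ⊤)
    (hΛ : InjectivesGenerate (MoritaRing A N M B)) : InjectivesGenerate A := by
  obtain ⟨n, hn⟩ := exists_hasProjectiveDimensionLT_of_lt_top h
  exact hΛ.of_functor (cornerA A N M B) _ (restrictScalarsCompCornerA A N M B)
    fun I _ ↦ ⟨n + 1, hasInjectiveDimensionLT_cornerA n I⟩

theorem injectivesGenerate_right (h : projectiveDimension (ModuleCat.of B M) < ⊤)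
    (hΛ : InjectivesGenerate (MoritaRing A N M B)) : InjectivesGenerate B :=
  injectivesGenerate_left (N := M) (M := N) (B := A) h (hΛ.of_ringEquiv (swap B M N A))

end Corner

end MoritaRing

/-! ### The submodules annihilated by the kernel of a surjective ring homomorphism -/

namespace ModuleCat

variable {R S : Type u} [Ring R] [Ring S] (f : R →+* S)

instance : (coextendScalars.{u, u, u} f).Additive where
  map_add := rfl

/-- For a surjective ring homomorphism `f : R → S`, the functor that takes an `R`-module `X` to
`Hom_R(S, X)`, that is, to the submodule of `X` annihilated by the kernel of `f`. -/
noncomputable abbrev kerTorsion : ModuleCat.{u} R ⥤ ModuleCat.{u} R :=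
  coextendScalars f ⋙ restrictScalars f

/-- Evaluation at `1 : S`, the inclusion of the submodule annihilated by the kernel of `f`. -/
noncomputable def kerTorsionι : kerTorsion f ⟶ 𝟭 _ := (restrictCoextendScalarsAdj f).counit

variable {f} (hf : Function.Surjective f) (X : ModuleCat.{u} R)

theorem kerTorsionι_smul_eq_zero (r : R) (hr : f r = 0) (y : (kerTorsion f).obj X) :
    r • ((kerTorsionι f).app X).hom y = 0 := by
  rw [← map_smul]
  have : r • y = 0 := (congr_arg (· • (show (coextendScalars f).obj X from y)) hr).trans
    (zero_smul S (show (coextendScalars f).obj X from y))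
  rw [this, map_zero]

include hf

theorem kerTorsionι_injective : Function.Injective ((kerTorsionι f).app X).hom := by
  rw [injective_iff_map_eq_zero]
  intro y hy
  let g : (restrictScalars f).obj (of S S) →ₗ[R] X := CoextendScalars.equiv f X y
  refine CoextendScalars.ext (g' := 0) (LinearMap.ext fun s ↦ ?_)
  obtain ⟨r, rfl⟩ := hf s
  have h₁ : g (1 : S) = 0 := hy
  have h₂ : g (f r) = r • g (1 : S) :=
    (congr_arg g (mul_one (f r)).symm).trans (g.map_smul r _)
  exact h₂.trans ((congr_arg (r • ·) h₁).trans (smul_zero r))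

/-- An element annihilated by the kernel of `f` is in the image of `kerTorsion f`. -/
theorem exists_kerTorsionι_eq {x : X} (hx : ∀ r, f r = 0 → r • x = 0) :
    ∃ y, ((kerTorsionι f).app X).hom y = x := by
  have hr (r r' : R) (h : f r = f r') : r • x = r' • x := by
    rw [← sub_eq_zero, ← sub_smul]
    exact hx _ (by rw [map_sub, h, sub_self])
  have hσ := Function.rightInverse_surjInv hf
  let g : (restrictScalars f).obj (of S S) →ₗ[R] X :=
    { toFun s := Function.surjInv hf s • x
      map_add' s t := by
        rw [← add_smul]
        refine hr _ _ ?_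
        rw [map_add]
        exact (hσ _).trans (congr_arg₂ (· + ·) (hσ s) (hσ t)).symm
      map_smul' r s := by
        rw [RingHom.id_apply, smul_smul]
        refine hr _ _ ?_
        rw [map_mul]
        exact (hσ _).trans (congr_arg (f r * ·) (hσ s)).symm }
  refine ⟨(CoextendScalars.equiv f X).symm g, ?_⟩
  refine Eq.trans ?_ (one_smul R x)
  exact hr _ _ (by rw [hσ, map_one])

end ModuleCat

/-- If injectives generate for `S` and `S` has finite projective dimension as a left `R`-module,
then the complexes of right `S`-modules, viewed as complexes of right `R`-modules, lie in every
localizing subcategory that contains the injective modules. -/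
theorem IsLocalizing.restrictScalars_obj {R S : Type u} [Ring R] [Ring S]
    [HasDerivedCategory.{u + 1} (ModuleCat.{u} Rᵐᵒᵖ)]
    {P : ObjectProperty (DerivedCategory (ModuleCat.{u} Rᵐᵒᵖ))}
    (hP : IsLocalizing.{u + 1, u + 1, u} P) (hI : injectivesInDegreeZero (ModuleCat.{u} Rᵐᵒᵖ) ≤ P)
    (f : R →+* S) (n : ℕ)
    [HasProjectiveDimensionLT ((ModuleCat.restrictScalars f).obj (ModuleCat.of S S)) n]
    (hS : InjectivesGenerate S) (K : CochainComplex (ModuleCat.{u} Sᵐᵒᵖ) ℤ) :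
    P (DerivedCategory.Q.obj
      (((ModuleCat.restrictScalars (RingHom.op f)).mapHomologicalComplex _).obj K)) := by
  let := HasDerivedCategory.standard (ModuleCat.{u} Sᵐᵒᵖ)
  exact hP.mapDerivedCategory_obj (ModuleCat.restrictScalars (RingHom.op f)) hI
    (fun I _ ↦ ⟨n, ModuleCat.hasInjectiveDimensionLT_restrictScalars f n I⟩) hS K

/-! ### Generation by the modules over the diagonal entries -/

/-- Let `α₁ : T₁ ⟶ 𝟭` and `α₂ : T₂ ⟶ 𝟭` be such that `T₁ X × T₂ X → X` is injective for all modules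
`X`, with a cokernel `Y` for which `T₁ Y × T₂ Y → Y` is bijective. Then each complex `K` is an
extension of a complex `T₁ C ⊕ T₂ C` by `T₁ K ⊕ T₂ K`. -/
theorem IsLocalizing.of_two_step_filtration {R : Type u} [Ring R]
    [HasDerivedCategory.{w} (ModuleCat.{u} R)]
    {P : ObjectProperty (DerivedCategory (ModuleCat.{u} R))}
    (hP : IsLocalizing.{w, u + 1, v} P) {T₁ T₂ : ModuleCat.{u} R ⥤ ModuleCat.{u} R}
    [T₁.Additive] [T₂.Additive] (α₁ : T₁ ⟶ 𝟭 _) (α₂ : T₂ ⟶ 𝟭 _)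
    (hinj : ∀ (X : ModuleCat.{u} R) (y₁ : T₁.obj X) (y₂ : T₂.obj X),
      (α₁.app X).hom y₁ + (α₂.app X).hom y₂ = 0 → y₁ = 0 ∧ y₂ = 0)
    (hsurj : ∀ {X Y : ModuleCat.{u} R} (p : X ⟶ Y), Function.Surjective p.hom →
      (∀ y₁, p.hom ((α₁.app X).hom y₁) = 0) → (∀ y₂, p.hom ((α₂.app X).hom y₂) = 0) →
      ∀ y : Y, ∃ y₁ y₂, (α₁.app Y).hom y₁ + (α₂.app Y).hom y₂ = y)
    (h₁ : ∀ K : CochainComplex (ModuleCat.{u} R) ℤ,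
      P (DerivedCategory.Q.obj ((T₁.mapHomologicalComplex _).obj K)))
    (h₂ : ∀ K : CochainComplex (ModuleCat.{u} R) ℤ,
      P (DerivedCategory.Q.obj ((T₂.mapHomologicalComplex _).obj K)))
    (K : CochainComplex (ModuleCat.{u} R) ℤ) : P (DerivedCategory.Q.obj K) := by
  have := hP.isClosedUnderIsomorphisms
  let c := ComplexShape.up ℤ
  let T (K : CochainComplex (ModuleCat.{u} R) ℤ) : CochainComplex (ModuleCat.{u} R) ℤ :=
    (T₁.mapHomologicalComplex c).obj K ⊞ (T₂.mapHomologicalComplex c).obj K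
  let β₁ (K : CochainComplex (ModuleCat.{u} R) ℤ) : (T₁.mapHomologicalComplex c).obj K ⟶ K :=
    { f n := α₁.app (K.X n)
      comm' n m _ := (α₁.naturality (K.d n m)).symm }
  let β₂ (K : CochainComplex (ModuleCat.{u} R) ℤ) : (T₂.mapHomologicalComplex c).obj K ⟶ K :=
    { f n := α₂.app (K.X n)
      comm' n m _ := (α₂.naturality (K.d n m)).symm }
  let β (K : CochainComplex (ModuleCat.{u} R) ℤ) : T K ⟶ K := biprod.desc (β₁ K) (β₂ K)
  have hT (K) : P (DerivedCategory.Q.obj (T K)) :=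
    hP.Q_X₂_of_shortExact (ShortComplex.Splitting.ofHasBinaryBiproduct
      ((T₁.mapHomologicalComplex c).obj K) ((T₂.mapHomologicalComplex c).obj K)).shortExact
      (h₁ K) (h₂ K)
  have inl_β (K) : biprod.inl ≫ β K = β₁ K := biprod.inl_desc _ _
  have inr_β (K) : biprod.inr ≫ β K = β₂ K := biprod.inr_desc _ _
  have inl_β_apply (K : CochainComplex (ModuleCat.{u} R) ℤ) (n : ℤ)
      (y : ((T₁.mapHomologicalComplex c).obj K).X n) :
      ((β K).f n).hom (((biprod.inl : _ ⟶ T K).f n).hom y) = (α₁.app (K.X n)).hom y :=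
    ConcreteCategory.congr_hom (HomologicalComplex.congr_hom (inl_β K) n) y
  have inr_β_apply (K : CochainComplex (ModuleCat.{u} R) ℤ) (n : ℤ)
      (y : ((T₂.mapHomologicalComplex c).obj K).X n) :
      ((β K).f n).hom (((biprod.inr : _ ⟶ T K).f n).hom y) = (α₂.app (K.X n)).hom y :=
    ConcreteCategory.congr_hom (HomologicalComplex.congr_hom (inr_β K) n) y
  have mono (K) : Mono (β K) := by
    refine HomologicalComplex.mono_of_mono_f _ fun n ↦ ?_
    rw [ModuleCat.mono_iff_injective, injective_iff_map_eq_zero]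
    intro z hz
    have hz' : ((biprod.inl : _ ⟶ T K).f n).hom (((biprod.fst : T K ⟶ _).f n).hom z) +
        ((biprod.inr : _ ⟶ T K).f n).hom (((biprod.snd : T K ⟶ _).f n).hom z) = z :=
      ConcreteCategory.congr_hom (HomologicalComplex.congr_hom
        (biprod.total (X := (T₁.mapHomologicalComplex c).obj K)) n) z
    obtain ⟨e₁, e₂⟩ := hinj (K.X n) (((biprod.fst : T K ⟶ _).f n).hom z)
      (((biprod.snd : T K ⟶ _).f n).hom z) (by
        rw [← inl_β_apply, ← inr_β_apply, ← map_add, hz']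
        exact hz)
    exact hz'.symm.trans ((congr_arg₂ (· + ·) ((congr_arg _ e₁).trans (map_zero _))
      ((congr_arg _ e₂).trans (map_zero _))).trans (add_zero 0))
  -- The cokernel `C` of `T K ⟶ K` satisfies `T C ≅ C`.
  let S : ShortComplex (CochainComplex (ModuleCat.{u} R) ℤ) :=
    ShortComplex.mk _ _ (cokernel.condition (β K))
  have hS : S.ShortExact :=
    { exact := ShortComplex.exact_cokernel _
      mono_f := mono K }
  refine hP.Q_X₂_of_shortExact hS (hT K) ?_
  have hβ (n : ℤ) (z : (T K).X n) : (S.g.f n).hom (((β K).f n).hom z) = 0 :=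
    ConcreteCategory.congr_hom (HomologicalComplex.congr_hom (cokernel.condition (β K)) n) z
  have epi : Epi (β S.X₃) := by
    refine HomologicalComplex.epi_of_epi_f _ fun n ↦ ?_
    rw [ModuleCat.epi_iff_surjective]
    intro y
    obtain ⟨y₁, y₂, rfl⟩ := hsurj (S.g.f n)
      ((ModuleCat.epi_iff_surjective _).1 inferInstance)
      (fun y₁ ↦ (congr_arg (S.g.f n).hom (inl_β_apply K n y₁).symm).trans (hβ n _))
      (fun y₂ ↦ (congr_arg (S.g.f n).hom (inr_β_apply K n y₂).symm).trans (hβ n _)) y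
    exact ⟨((biprod.inl : _ ⟶ T S.X₃).f n).hom y₁ + ((biprod.inr : _ ⟶ T S.X₃).f n).hom y₂, by
      rw [map_add]; exact congr_arg₂ _ (inl_β_apply _ _ _) (inr_β_apply _ _ _)⟩
  have := mono S.X₃
  have := isIso_of_mono_of_epi (β S.X₃)
  exact P.prop_of_iso (DerivedCategory.Q.mapIso (asIso (β S.X₃))) (hT _)

namespace MoritaRing

variable {A N M B : Type u} [Ring A] [Ring B] [AddCommGroup N] [AddCommGroup M]
  [Module A N] [Module Bᵐᵒᵖ N] [SMulCommClass A Bᵐᵒᵖ N]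
  [Module B M] [Module Aᵐᵒᵖ M] [SMulCommClass B Aᵐᵒᵖ M]

theorem toA_op_surjective : Function.Surjective (RingHom.op (toA A N M B)) :=
  fun a ↦ ⟨op ⟨a.unop, 0, 0, 0⟩, rfl⟩

theorem toB_op_surjective : Function.Surjective (RingHom.op (toB A N M B)) :=
  fun b ↦ ⟨op ⟨0, 0, 0, b.unop⟩, rfl⟩

theorem one_smul_eq_add (X : ModuleCat.{u} (MoritaRing A N M B)ᵐᵒᵖ) (x : X) :
    (op ⟨1, 0, 0, 0⟩ : (MoritaRing A N M B)ᵐᵒᵖ) • x +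
      (op ⟨0, 0, 0, 1⟩ : (MoritaRing A N M B)ᵐᵒᵖ) • x = x := by
  have h : (⟨1, 0, 0, 0⟩ + ⟨0, 0, 0, 1⟩ : MoritaRing A N M B) = 1 := by ext <;> simp
  rw [← add_smul, ← MulOpposite.op_add, h, op_one, one_smul]

theorem eq_zero_of_kerTorsionι_add_eq_zero (X : ModuleCat.{u} (MoritaRing A N M B)ᵐᵒᵖ)
    (y₁ : (ModuleCat.kerTorsion (RingHom.op (toA A N M B))).obj X)
    (y₂ : (ModuleCat.kerTorsion (RingHom.op (toB A N M B))).obj X)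
    (h : ((ModuleCat.kerTorsionι (RingHom.op (toA A N M B))).app X).hom y₁ +
      ((ModuleCat.kerTorsionι (RingHom.op (toB A N M B))).app X).hom y₂ = 0) :
    y₁ = 0 ∧ y₂ = 0 := by
  have hA := ModuleCat.kerTorsionι_smul_eq_zero X
    (op ⟨0, 0, 0, 1⟩ : (MoritaRing A N M B)ᵐᵒᵖ) rfl y₁
  have hB := ModuleCat.kerTorsionι_smul_eq_zero X
    (op ⟨1, 0, 0, 0⟩ : (MoritaRing A N M B)ᵐᵒᵖ) rfl y₂
  have h₂ : ((ModuleCat.kerTorsionι (RingHom.op (toB A N M B))).app X).hom y₂ = 0 := by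
    have := congr_arg ((op ⟨0, 0, 0, 1⟩ : (MoritaRing A N M B)ᵐᵒᵖ) • ·) h
    rw [smul_add, hA, smul_zero, zero_add] at this
    refine (one_smul_eq_add X _).symm.trans ?_
    refine (congr_arg₂ (· + ·) hB this).trans (add_zero 0)
  have h₁ := h
  rw [h₂, add_zero] at h₁
  exact ⟨ModuleCat.kerTorsionι_injective toA_op_surjective X (h₁.trans (map_zero _).symm),
    ModuleCat.kerTorsionι_injective toB_op_surjective X (h₂.trans (map_zero _).symm)⟩

/-- If an element of a right module over the Morita context ring is annihilated by the off-diagonal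
matrices, then it is the sum of its two diagonal components, which come from a right `A`-module and
a right `B`-module. -/
theorem exists_kerTorsionι_add_eq (X : ModuleCat.{u} (MoritaRing A N M B)ᵐᵒᵖ) (x : X)
    (hx : ∀ (n : N) (m : M), (op ⟨0, n, m, 0⟩ : (MoritaRing A N M B)ᵐᵒᵖ) • x = 0) :
    ∃ y₁ y₂, ((ModuleCat.kerTorsionι (RingHom.op (toA A N M B))).app X).hom y₁ +
      ((ModuleCat.kerTorsionι (RingHom.op (toB A N M B))).app X).hom y₂ = x := by
  obtain ⟨y₁, hy₁⟩ := ModuleCat.exists_kerTorsionι_eq toA_op_surjective X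
    (x := (op ⟨1, 0, 0, 0⟩ : (MoritaRing A N M B)ᵐᵒᵖ) • x) fun r hr ↦ by
      rw [smul_smul, ← hx r.unop.n 0]
      refine congr_arg (fun r : MoritaRing A N M B ↦ op r • x) ?_
      have hr' : r.unop.a = 0 := congr_arg unop hr
      ext <;> simp [hr']
  obtain ⟨y₂, hy₂⟩ := ModuleCat.exists_kerTorsionι_eq toB_op_surjective X
    (x := (op ⟨0, 0, 0, 1⟩ : (MoritaRing A N M B)ᵐᵒᵖ) • x) fun r hr ↦ by
      rw [smul_smul, ← hx 0 r.unop.m]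
      refine congr_arg (fun r : MoritaRing A N M B ↦ op r • x) ?_
      have hr' : r.unop.b = 0 := congr_arg unop hr
      ext <;> simp [hr']
  exact ⟨y₁, y₂, by rw [hy₁, hy₂, one_smul_eq_add]⟩

theorem exists_kerTorsionι_add_eq_of_surjective {X Y : ModuleCat.{u} (MoritaRing A N M B)ᵐᵒᵖ}
    (p : X ⟶ Y) (hp : Function.Surjective p.hom)
    (h₁ : ∀ y₁, p.hom (((ModuleCat.kerTorsionι (RingHom.op (toA A N M B))).app X).hom y₁) = 0)
    (h₂ : ∀ y₂, p.hom (((ModuleCat.kerTorsionι (RingHom.op (toB A N M B))).app X).hom y₂) = 0)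
    (y : Y) : ∃ y₁ y₂, ((ModuleCat.kerTorsionι (RingHom.op (toA A N M B))).app Y).hom y₁ +
      ((ModuleCat.kerTorsionι (RingHom.op (toB A N M B))).app Y).hom y₂ = y := by
  refine exists_kerTorsionι_add_eq Y y fun n m ↦ ?_
  obtain ⟨x, rfl⟩ := hp y
  -- The product of two off-diagonal matrices is zero.
  obtain ⟨y₁, y₂, h⟩ := exists_kerTorsionι_add_eq X
    ((op ⟨0, n, m, 0⟩ : (MoritaRing A N M B)ᵐᵒᵖ) • x) fun n' m' ↦ by
      rw [smul_smul, ← zero_smul (MoritaRing A N M B)ᵐᵒᵖ x]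
      refine congr_arg (fun r : MoritaRing A N M B ↦ op r • x) ?_
      ext <;> simp
  rw [← map_smul, ← h, map_add, h₁, h₂, add_zero]

/-- Injective generation ascends to the Morita context ring, since the complexes that come from `A`
and from `B` generate all others by extensions. -/
theorem injectivesGenerate_of_diagonal
    (hA : projectiveDimension ((Z_A A N M B).obj (ModuleCat.of A A)) < ⊤)
    (hB : projectiveDimension ((Z_B A N M B).obj (ModuleCat.of B B)) < ⊤)
    (hA' : InjectivesGenerate A) (hB' : InjectivesGenerate B) :
    InjectivesGenerate (MoritaRing A N M B) := by
  let := HasDerivedCategory.standard (ModuleCat.{u} (MoritaRing A N M B)ᵐᵒᵖ)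
  obtain ⟨n, hn⟩ := exists_hasProjectiveDimensionLT_of_lt_top hA
  obtain ⟨m, hm⟩ := exists_hasProjectiveDimensionLT_of_lt_top hB
  dsimp only [Z_A] at hn
  dsimp only [Z_B] at hm
  refine injectivesGenerate_iff.2 fun P hP hI ↦ hP.of_two_step_filtration
    (ModuleCat.kerTorsionι (RingHom.op (toA A N M B)))
    (ModuleCat.kerTorsionι (RingHom.op (toB A N M B)))
    eq_zero_of_kerTorsionι_add_eq_zero exists_kerTorsionι_add_eq_of_surjective
    (fun K ↦ ?_) (fun K ↦ ?_)
  · exact hP.restrictScalars_obj hI (toA A N M B) n hA'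
      (((ModuleCat.coextendScalars _).mapHomologicalComplex _).obj K)
  · exact hP.restrictScalars_obj hI (toB A N M B) m hB'
      (((ModuleCat.coextendScalars _).mapHomologicalComplex _).obj K)

end MoritaRing

theorem mainTheorem6 (A B N M : Type u) [Ring A] [Ring B] [AddCommGroup N] [AddCommGroup M]
    [Module A N] [Module Bᵐᵒᵖ N] [SMulCommClass A Bᵐᵒᵖ N]
    [Module B M] [Module Aᵐᵒᵖ M] [SMulCommClass B Aᵐᵒᵖ M] :
    (projectiveDimension (ModuleCat.of A N) < ⊤ →
      InjectivesGenerate (MoritaRing A N M B) → InjectivesGenerate A) ∧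
    (projectiveDimension (ModuleCat.of B M) < ⊤ →
      InjectivesGenerate (MoritaRing A N M B) → InjectivesGenerate B) ∧
    (projectiveDimension ((MoritaRing.Z_A A N M B).obj (ModuleCat.of A A)) < ⊤ →
      projectiveDimension ((MoritaRing.Z_B A N M B).obj (ModuleCat.of B B)) < ⊤ →
      InjectivesGenerate A → InjectivesGenerate B → InjectivesGenerate (MoritaRing A N M B)) := by
  exact ⟨MoritaRing.injectivesGenerate_left, MoritaRing.injectivesGenerate_right,
    MoritaRing.injectivesGenerate_of_diagonal⟩
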